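/- Let $n\ge 2$ and let $e_1,\dots,e_n$ be the standard basis of Euclidean space $\mathbb{R}^n$. Consider the root system of type $C_n$ with simple roots $\alpha_i=e_i-e_{i+1}$ for $1\le i<n$ and $\alpha_n=2e_n$, simple coroots $\alpha_i^\vee=2\alpha_i/(\alpha_i,\alpha_i)$, coroot lattice $R^\vee=\bigoplus_{i=1}^n\mathbb{Z}\alpha_i^\vee$, and Weyl group $W$ generated by the orthogonal reflections $s_1,\dots,s_n$ in the hyperplanes $\alpha_1^\perp,\dots,\alpha_n^\perp$. For $w\in W$ put $\mathrm{Mod}(w)=(w-\mathrm{Id})R^\vee$ and $\mathrm{Mov}(w)=(w-\mathrm{Id})\mathbb{R}^n$; say that $w$ fills its move-set if $\mathrm{Mod}(w)=\mathrm{Mov}(w)\cap R^\vee$. Let $(\beta,\gamma)$ be a pair of (possibly empty) finite sequences of positive integers, $\beta=(\beta_1,\dots,\beta_p)$ weakly decreasing and $\gamma=(\gamma_1,\dots,\gamma_q)$ weakly increasing, with $|\beta|+|\gamma|=n$, where $|\cdot|$ is the sum of the parts. Put $j^\beta_k=\beta_1+\dots+\beta_{k-1}$ and $j^\gamma_k=\gamma_1+\dots+\gamma_{k-1}$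 (so $j^\beta_1=j^\gamma_1=0$), and let $t_0=s_n$ and $t_i=s_{n-i}\,t_{i-1}\,s_{n-i}$ for $1\le i\le n-1$. Define $w_\beta=w^\beta_1\cdots w^\beta_p$ and $w_\gamma=w^\gamma_1\cdots w^\gamma_q$, where $$w^\beta_k=s_{j^\beta_k+1}s_{j^\beta_k+2}\cdots s_{j^\beta_k+\beta_k-1},\qquad w^\gamma_k=t_{j^\gamma_k}\,s_{n-(j^\gamma_k+1)}\,s_{n-(j^\gamma_k+2)}\cdots s_{n-(j^\gamma_k+\gamma_k)+1},$$ with empty products equal to $1$ (so $w^\beta_k=1$ if $\beta_k=1$ and $w^\gamma_k=t_{j^\gamma_k}$ if $\gamma_k=1$), and let $w_{\beta,\gamma}=w_\beta w_\gamma$. The conjugacy class of $w\in W$ is said to be indexed by $(\beta,\gamma)$ if it contains $w_{\beta,\gamma}$. Then the conjugacy class of every $w\in W$ is indexed by some such pair. Moreover, if the conjugacy class of $w$ is indexed by $(\beta,\gamma)$, the following are equivalent: 1. $w$ fills its move-set; 2. $w_\beta$ lies in the type $A_{n-1}$ parabolic subgroup $\langle s_1,\dots,s_{n-1}\rangle$,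 and $w$ is conjugate to $w_\beta$ in $W$; 3. $w$ is conjugate in $W$ to some element of $\langle s_1,\dots,s_{n-1}\rangle$; 4. $|\gamma|=0$. -/

import Mathlib

namespace TypeC

/-- The Euclidean space `ℝⁿ` on which the Weyl group acts; it is identified with its dual by the
standard inner product. -/
abbrev V (n : ℕ) : Type := EuclideanSpace ℝ (Fin n)

/-- The standard basis vector `e_i` of `ℝⁿ`, for `1 ≤ i ≤ n` (numbered from `1`). -/
noncomputable def stdVec (n i : ℕ) : V n :=
  WithLp.toLp 2 (fun k : Fin n => if (k : ℕ) + 1 = i then (1 : ℝ) else 0)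

/-- The simple roots of type `C_n` in Bourbaki's numbering: `α_i = e_i - e_{i+1}` for `1 ≤ i < n`
and `α_n = 2 e_n`. (Only the indices `1 ≤ i ≤ n` are used.) -/
noncomputable def simpleRoot (n i : ℕ) : V n :=
  if i = n then (2 : ℝ) • stdVec n n else stdVec n i - stdVec n (i + 1)

/-- The simple coroots `α_i^∨ = 2 α_i / (α_i, α_i)`. -/
noncomputable def simpleCoroot (n i : ℕ) : V n :=
  (2 / inner ℝ (simpleRoot n i) (simpleRoot n i) : ℝ) • simpleRoot n i

/-- The orthogonal reflection in the hyperplane orthogonal to the simple root `α_i`. -/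
noncomputable def reflectionMap (n i : ℕ) : V n ≃ₗᵢ[ℝ] V n :=
  (Submodule.span ℝ {simpleRoot n i})ᗮ.reflection

/-- The finite Weyl group of type `C_n`, generated by the reflections in the simple roots. -/
noncomputable def weylGroup (n : ℕ) : Subgroup (V n ≃ₗᵢ[ℝ] V n) :=
  Subgroup.closure {g | ∃ i, 1 ≤ i ∧ i ≤ n ∧ g = reflectionMap n i}

theorem reflectionMap_mem (n i : ℕ) (h : 1 ≤ i ∧ i ≤ n) : reflectionMap n i ∈ weylGroup n :=
  Subgroup.subset_closure ⟨i, h.1, h.2, rfl⟩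

/-- The simple reflection `s_i`, for `1 ≤ i ≤ n`, as an element of the Weyl group. (For indices
outside `{1, …, n}`, which are never used, the value is `1`.) -/
noncomputable def s (n i : ℕ) : weylGroup n :=
  if h : 1 ≤ i ∧ i ≤ n then ⟨reflectionMap n i, reflectionMap_mem n i h⟩ else 1

/-- The type `A_{n-1}` standard parabolic subgroup, generated by `s_1, …, s_{n-1}`. -/
noncomputable def parabolicA (n : ℕ) : Subgroup (weylGroup n) :=
  Subgroup.closure {g | ∃ i, 1 ≤ i ∧ i < n ∧ g = s n i}

/-- The coroot lattice `R^∨ = ⨁ ℤ α_i^∨`. -/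
noncomputable def corootLattice (n : ℕ) : Submodule ℤ (V n) :=
  Submodule.span ℤ {v | ∃ i, 1 ≤ i ∧ i ≤ n ∧ v = simpleCoroot n i}

/-- The linear map `w - Id` on `ℝⁿ`. -/
noncomputable def subId (n : ℕ) (w : weylGroup n) : V n →ₗ[ℝ] V n :=
  (w : V n ≃ₗᵢ[ℝ] V n).toLinearEquiv.toLinearMap - LinearMap.id

/-- The move-set `Mov(w) = Im(w - Id)`. -/
noncomputable def moveSet (n : ℕ) (w : weylGroup n) : Submodule ℝ (V n) :=
  LinearMap.range (subId n w)

/-- The mod-set `Mod(w) = (w - Id) R^∨`. -/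
noncomputable def modSet (n : ℕ) (w : weylGroup n) : Submodule ℤ (V n) :=
  (corootLattice n).map ((subId n w).restrictScalars ℤ)

/-- `w` fills its move-set: `Mod(w) = Mov(w) ∩ R^∨`. -/
def FillsMoveSet (n : ℕ) (w : weylGroup n) : Prop :=
  (modSet n w : Set (V n)) = (moveSet n w : Set (V n)) ∩ (corootLattice n : Set (V n))

/-- `(β, γ)` is a pair of partitions (finite sequences of positive integers), `β` weakly
decreasing, `γ` weakly increasing, with `|β| + |γ| = n`. -/
structure IsPartitionPair (n : ℕ) (β γ : List ℕ) : Prop where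
  pos_left : ∀ b ∈ β, 1 ≤ b
  pos_right : ∀ c ∈ γ, 1 ≤ c
  decreasing : β.Pairwise (fun a b => b ≤ a)
  increasing : γ.Pairwise (fun a b => a ≤ b)
  sum_eq : β.sum + γ.sum = n

/-- The positive block `s_{j+1} s_{j+2} ⋯ s_{j+b-1}`. -/
noncomputable def posBlock (n j b : ℕ) : weylGroup n :=
  ((List.range (b - 1)).map (fun i => s n (j + 1 + i))).prod

/-- The product of the positive blocks of lengths `β_1, β_2, …`, the first one starting at `j`, and
each later one starting where the previous one ends. -/
noncomputable def posBlocks (n : ℕ) : ℕ → List ℕ → weylGroup n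
  | _, [] => 1
  | j, b :: β => posBlock n j b * posBlocks n (j + b) β

/-- The element `w_β = w^β_1 ⋯ w^β_p`. -/
noncomputable def wBeta (n : ℕ) (β : List ℕ) : weylGroup n := posBlocks n 0 β

/-- The elements `t_0 = s_n` and `t_i = s_{n-i} t_{i-1} s_{n-i}` for `1 ≤ i ≤ n - 1`. -/
noncomputable def t (n : ℕ) : ℕ → weylGroup n
  | 0 => s n n
  | i + 1 => s n (n - (i + 1)) * t n i * s n (n - (i + 1))

/-- The negative block `t_j s_{n-(j+1)} s_{n-(j+2)} ⋯ s_{n-(j+c)+1}`. -/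
noncomputable def negBlock (n j c : ℕ) : weylGroup n :=
  t n j * ((List.range (c - 1)).map (fun i => s n (n - (j + 1 + i)))).prod

/-- The product of the negative blocks of lengths `γ_1, γ_2, …`, the first one starting at `j`, and
each later one starting where the previous one ends. -/
noncomputable def negBlocks (n : ℕ) : ℕ → List ℕ → weylGroup n
  | _, [] => 1
  | j, c :: γ => negBlock n j c * negBlocks n (j + c) γ

/-- The element `w_γ = w^γ_1 ⋯ w^γ_q`. -/
noncomputable def wGamma (n : ℕ) (γ : List ℕ) : weylGroup n := negBlocks n 0 γ

/-- The conjugacy class of `w` in the Weyl group is indexed by the pair of partitions `(β, γ)`: it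
contains the representative `w_{β,γ} = w_β w_γ`. -/
def IsIndexedBy (n : ℕ) (w : weylGroup n) (β γ : List ℕ) : Prop :=
  IsPartitionPair n β γ ∧ IsConj w (wBeta n β * wGamma n γ)

end TypeC

/-!
The Weyl group of type `C_n` is the group of all signed permutations of `e_1, …, e_n`, and its
coroot lattice is `ℤⁿ` (`mem_corootLattice_iff`); after this, everything is read off from cycles.

*Classification* (`exists_isIndexedBy`). A signed permutation `w` decomposes into cycles
`e_i, w e_i, …, w ^ (b - 1) e_i` with `w ^ b e_i = ± e_i`. The representative `w_{β,γ}` has cycles of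
the same kind: relative to the order `e_1, e_2, …` the block for `β_k` is a cycle closing up with the
sign `1`, and relative to the reversed order `e_n, e_{n-1}, …` the block for `γ_k` is a cycle closing
up with the sign `-1` (`isBlock_posBlock`, `isBlock_negBlock`). Sorting the cycles of `w` by sign and
length and matching them with the blocks gives a signed permutation that conjugates `w_{β,γ}`
to `w` (`apply_blocksProd_eq`).

*Equivalence*. Filling the move-set is invariant under conjugation (`FillsMoveSet.of_isConj`) and
means that whenever `w x - x` is integral, `x` can be replaced by an integral vector
(`fillsMoveSet_iff`). For an unsigned permutation, taking integer parts of the coordinates does this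
(`fillsMoveSet_of_mem_parabolicA`). A negative cycle `F_0 ↦ ⋯ ↦ F_{c-1} ↦ -F_0` is an obstruction:
`F_0` is the image under `w - Id` of `-½ ∑ F_k`, but of no integral vector (`not_fillsMoveSet`).
So an element that fills its move-set has no negative cycle, that is, `γ` is empty; then `w` is
conjugate to `w_β`, which is an unsigned permutation.
-/

namespace TypeC

variable {n : ℕ}

/-! ### The standard basis and the simple reflections -/

theorem stdVec_succ (i : Fin n) : stdVec n (i + 1) = EuclideanSpace.single i (1 : ℝ) := by
  ext k
  simp [stdVec, Fin.ext_iff]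

theorem inner_stdVec (i : Fin n) (x : V n) : inner ℝ (stdVec n (i + 1)) x = x i := by
  simp [stdVec_succ, EuclideanSpace.inner_single_left]

theorem inner_stdVec_stdVec {i j : ℕ} (hi : 1 ≤ i) (hin : i ≤ n) :
    inner ℝ (stdVec n i) (stdVec n j) = if i = j then (1 : ℝ) else 0 := by
  obtain ⟨k, rfl⟩ : ∃ k, i = k + 1 := ⟨i - 1, by omega⟩
  rw [inner_stdVec ⟨k, by omega⟩]
  simp [stdVec]

theorem eq_sum_stdVec (x : V n) : x = ∑ i : Fin n, x i • stdVec n (i + 1) := by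
  ext k
  simp [stdVec_succ, Finset.sum_apply, Pi.single_apply]

theorem isometry_ext {u v : V n ≃ₗᵢ[ℝ] V n}
    (h : ∀ i : Fin n, u (stdVec n (i + 1)) = v (stdVec n (i + 1))) : u = v := by
  ext1 x
  rw [eq_sum_stdVec x]
  simp only [map_sum, map_smul, h]

theorem reflectionMap_apply (i : ℕ) (x : V n) :
    reflectionMap n i x = x - (2 * (inner ℝ (simpleRoot n i) x /
      inner ℝ (simpleRoot n i) (simpleRoot n i))) • simpleRoot n i := by
  rw [reflectionMap, Submodule.reflection_orthogonal_apply, Submodule.reflection_singleton_apply,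
    real_inner_self_eq_norm_sq]
  simp only [RCLike.ofReal_real_eq_id, id]
  module

theorem inner_simpleRoot_self {i : ℕ} (hi : 1 ≤ i) (hin : i ≤ n) :
    inner ℝ (simpleRoot n i) (simpleRoot n i) = if i = n then (4 : ℝ) else 2 := by
  unfold simpleRoot
  split_ifs with h
  · subst h
    rw [inner_smul_left, inner_smul_right, inner_stdVec_stdVec hi le_rfl]
    norm_num
  · simp only [inner_sub_left, inner_sub_right]
    rw [inner_stdVec_stdVec hi hin, inner_stdVec_stdVec hi hin,
      inner_stdVec_stdVec (by omega) (by omega), inner_stdVec_stdVec (by omega) (by omega)]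
    norm_num

theorem s_last_apply_last (hn : 1 ≤ n) : (s n n).1 (stdVec n n) = -stdVec n n := by
  rw [s, dif_pos ⟨hn, le_rfl⟩]
  simp only
  rw [reflectionMap_apply, inner_simpleRoot_self hn le_rfl]
  simp only [simpleRoot, if_true, inner_smul_left]
  rw [inner_stdVec_stdVec hn le_rfl]
  norm_num
  module

theorem s_last_apply_of_ne {k : ℕ} (h : k ≠ n) : (s n n).1 (stdVec n k) = stdVec n k := by
  rcases Nat.eq_zero_or_pos n with rfl | hn
  · exact Subsingleton.elim _ _
  rw [s, dif_pos ⟨hn, le_rfl⟩]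
  simp only
  rw [reflectionMap_apply]
  simp only [simpleRoot, if_true, inner_smul_left]
  rw [inner_stdVec_stdVec hn le_rfl]
  simp [h.symm]

theorem s_apply {i : ℕ} (hi : 1 ≤ i) (hin : i < n) (k : ℕ) :
    (s n i).1 (stdVec n k) = stdVec n (Equiv.swap i (i + 1) k) := by
  rw [s, dif_pos ⟨hi, hin.le⟩]
  simp only
  rw [reflectionMap_apply, inner_simpleRoot_self hi hin.le]
  simp only [simpleRoot, if_neg hin.ne, inner_sub_left]
  rw [inner_stdVec_stdVec hi hin.le, inner_stdVec_stdVec (by omega) (by omega)]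
  rcases eq_or_ne k i with rfl | h1
  · simp
  rcases eq_or_ne k (i + 1) with rfl | h2
  · simp only [Equiv.swap_apply_right, if_neg h1.symm, if_true]
    module
  · rw [Equiv.swap_apply_of_ne_of_ne h1 h2]
    simp [h1.symm, h2.symm]

/-! ### The coroot lattice -/

/-- The coroot lattice of type `C_n` is `ℤⁿ`. -/
theorem mem_corootLattice_iff (x : V n) :
    x ∈ corootLattice n ↔ ∀ i, ∃ m : ℤ, x i = m := by
  have hcoroot : ∀ i, 1 ≤ i → i ≤ n → simpleCoroot n i =
      if i = n then stdVec n n else stdVec n i - stdVec n (i + 1) := by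
    intro i hi hin
    rw [simpleCoroot, inner_simpleRoot_self hi hin, simpleRoot]
    split_ifs
    · module
    · norm_num
  constructor
  · intro hx
    induction hx using Submodule.span_induction with
    | mem v hv =>
      obtain ⟨i, hi, hin, rfl⟩ := hv
      intro k
      rw [hcoroot i hi hin]
      split_ifs with h
      · exact ⟨if (k : ℕ) + 1 = n then 1 else 0, by simp [stdVec]⟩
      · exact ⟨(if (k : ℕ) + 1 = i then 1 else 0) - (if (k : ℕ) + 1 = i + 1 then 1 else 0),
          by simp [stdVec]⟩
    | zero => exact fun _ => ⟨0, by simp⟩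
    | add a b _ _ ha hb =>
      intro k
      obtain ⟨p, hp⟩ := ha k
      obtain ⟨q, hq⟩ := hb k
      exact ⟨p + q, by simp [hp, hq]⟩
    | smul c a _ ha =>
      intro k
      obtain ⟨p, hp⟩ := ha k
      exact ⟨c * p, by simp [hp]⟩
  · intro hx
    -- `e_i = α_i^∨ + e_{i+1}` and `e_n = α_n^∨`, so descend from `e_n`.
    have hstd : ∀ d, d < n → stdVec n (n - d) ∈ corootLattice n := by
      intro d
      induction d with
      | zero =>
        intro h
        refine Submodule.subset_span ⟨n, h, le_rfl, ?_⟩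
        rw [hcoroot n h le_rfl, if_pos rfl, Nat.sub_zero]
      | succ d ih =>
        intro h
        have h1 := ih (by omega)
        have h2 : simpleCoroot n (n - (d + 1)) ∈ corootLattice n :=
          Submodule.subset_span ⟨n - (d + 1), by omega, by omega, rfl⟩
        rw [hcoroot _ (by omega) (by omega), if_neg (by omega),
          show n - (d + 1) + 1 = n - d by omega] at h2
        simpa using Submodule.add_mem _ h2 h1
    rw [eq_sum_stdVec x]
    refine Submodule.sum_mem _ fun i _ => ?_
    obtain ⟨m, hm⟩ := hx i
    rw [hm, Int.cast_smul_eq_zsmul]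
    refine Submodule.smul_mem _ _ ?_
    have := hstd (n - (i + 1)) (by omega)
    rwa [show n - (n - ((i : ℕ) + 1)) = i + 1 by omega] at this

/-! ### Signed permutations -/

/-- The isometry `u` sends `e_i` to `a_i e_{σ(i)}` with signs `a_i = ±1`. -/
def ActsBy (u : V n ≃ₗᵢ[ℝ] V n) (σ : Equiv.Perm (Fin n)) (a : Fin n → ℝ) : Prop :=
  (∀ i, a i = 1 ∨ a i = -1) ∧ ∀ i : Fin n, u (stdVec n (i + 1)) = a i • stdVec n (σ i + 1)

theorem ActsBy.one : ActsBy (1 : V n ≃ₗᵢ[ℝ] V n) 1 1 :=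
  ⟨fun _ => Or.inl rfl, fun _ => by simp⟩

theorem ActsBy.mul {u v : V n ≃ₗᵢ[ℝ] V n} {σ τ : Equiv.Perm (Fin n)} {a b : Fin n → ℝ}
    (hu : ActsBy u σ a) (hv : ActsBy v τ b) :
    ActsBy (u * v) (σ * τ) fun i => b i * a (τ i) := by
  refine ⟨fun i => ?_, fun i => ?_⟩
  · rcases hu.1 (τ i) with h | h <;> rcases hv.1 i with h' | h' <;> simp [h, h']
  · rw [LinearIsometryEquiv.coe_mul, Function.comp_apply, hv.2, map_smul, hu.2, smul_smul,
      Equiv.Perm.mul_apply]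

theorem actsBy_one_mul {u v : V n ≃ₗᵢ[ℝ] V n} {σ τ : Equiv.Perm (Fin n)}
    (hu : ActsBy u σ 1) (hv : ActsBy v τ 1) : ActsBy (u * v) (σ * τ) 1 := by
  have h1 : (1 : Fin n → ℝ) = fun i => (1 : Fin n → ℝ) i * (1 : Fin n → ℝ) (τ i) :=
    funext fun _ => (one_mul _).symm
  rw [h1]
  exact hu.mul hv

theorem ActsBy.inv {u : V n ≃ₗᵢ[ℝ] V n} {σ : Equiv.Perm (Fin n)} {a : Fin n → ℝ}
    (hu : ActsBy u σ a) : ActsBy u⁻¹ σ⁻¹ fun i => a (σ⁻¹ i) := by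
  refine ⟨fun i => hu.1 _, fun i => u.injective ?_⟩
  have h1 : u (u⁻¹ (stdVec n (i + 1))) = stdVec n (i + 1) := u.apply_symm_apply _
  rw [h1, map_smul, hu.2, smul_smul, show σ (σ⁻¹ i) = i from σ.apply_symm_apply i,
    show a (σ⁻¹ i) * a (σ⁻¹ i) = 1 by
      rcases hu.1 (σ⁻¹ i) with h | h <;> rw [h] <;> norm_num, one_smul]

theorem ActsBy.apply_coord {u : V n ≃ₗᵢ[ℝ] V n} {σ : Equiv.Perm (Fin n)} {a : Fin n → ℝ}
    (hu : ActsBy u σ a) (x : V n) (i : Fin n) : u x (σ i) = a i * x i := by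
  rw [← inner_stdVec, ← inner_stdVec i x, ← u.inner_map_map (stdVec n (i + 1)), hu.2]
  rcases hu.1 i with h | h <;> simp [h]

theorem actsBy_s {i : ℕ} (hi : 1 ≤ i) (hin : i < n) :
    ActsBy (s n i).1 (Equiv.swap ⟨i - 1, by omega⟩ ⟨i, hin⟩) 1 := by
  refine ⟨fun _ => Or.inl rfl, fun k => ?_⟩
  rw [s_apply hi hin, Pi.one_apply, one_smul]
  congr 1
  simp only [Equiv.swap_apply_def, Fin.ext_iff, apply_ite Fin.val]
  split_ifs <;> omega

/-- Every element of the Weyl group is a signed permutation. -/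
theorem exists_actsBy (w : weylGroup n) : ∃ σ a, ActsBy w.1 σ a := by
  obtain ⟨w, hw⟩ := w
  simp only
  induction hw using Subgroup.closure_induction with
  | mem u hu =>
    obtain ⟨i, hi, hin, rfl⟩ := hu
    have hs : reflectionMap n i = (s n i).1 := by rw [s, dif_pos ⟨hi, hin⟩]
    rw [hs]
    rcases hin.eq_or_lt with rfl | hlt
    · refine ⟨1, fun k => if (k : ℕ) + 1 = i then -1 else 1, fun k => ?_, fun k => ?_⟩
      · dsimp only
        split_ifs <;> simp
      · dsimp only
        split_ifs with h
        · simp [h, s_last_apply_last hi]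
        · simp [s_last_apply_of_ne h]
    · exact ⟨_, _, actsBy_s hi hlt⟩
  | one => exact ⟨1, 1, ActsBy.one⟩
  | mul u v _ _ hu hv =>
    obtain ⟨σ, a, hu⟩ := hu
    obtain ⟨τ, b, hv⟩ := hv
    exact ⟨_, _, hu.mul hv⟩
  | inv u _ hu =>
    obtain ⟨σ, a, hu⟩ := hu
    exact ⟨_, _, hu.inv⟩

/-- The elements of the parabolic subgroup of type `A_{n-1}` are unsigned permutations. -/
theorem exists_actsBy_one_of_mem_parabolicA {w : weylGroup n} (hw : w ∈ parabolicA n) :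
    ∃ σ, ActsBy w.1 σ 1 := by
  induction hw using Subgroup.closure_induction with
  | mem u hu =>
    obtain ⟨i, hi, hin, rfl⟩ := hu
    exact ⟨_, actsBy_s hi hin⟩
  | one => exact ⟨1, ActsBy.one⟩
  | mul u v _ _ hu hv =>
    obtain ⟨σ, hu⟩ := hu
    obtain ⟨τ, hv⟩ := hv
    exact ⟨_, actsBy_one_mul hu hv⟩
  | inv u _ hu =>
    obtain ⟨σ, hu⟩ := hu
    exact ⟨_, hu.inv⟩

theorem map_mem_corootLattice (w : weylGroup n) {x : V n} (hx : x ∈ corootLattice n) :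
    w.1 x ∈ corootLattice n := by
  rw [mem_corootLattice_iff] at hx ⊢
  obtain ⟨σ, a, h⟩ := exists_actsBy w
  intro i
  obtain ⟨k, rfl⟩ := σ.surjective i
  obtain ⟨m, hm⟩ := hx k
  rw [h.apply_coord, hm]
  rcases h.1 k with h' | h'
  · exact ⟨m, by simp [h']⟩
  · exact ⟨-m, by simp [h']⟩

/-! ### Filling the move-set -/

/-- `w` fills its move-set iff every lattice vector of the form `w x - x` with `x` real is also of
the form `w z - z` with `z` in the lattice. -/
theorem fillsMoveSet_iff (w : weylGroup n) : FillsMoveSet n w ↔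
    ∀ x : V n, w.1 x - x ∈ corootLattice n →
      ∃ z ∈ corootLattice n, w.1 z - z = w.1 x - x := by
  have hmod : ∀ y, y ∈ (modSet n w : Set (V n)) ↔ ∃ z ∈ corootLattice n, w.1 z - z = y :=
    fun y => Iff.rfl
  have hmov : ∀ y, y ∈ (moveSet n w : Set (V n)) ↔ ∃ x, w.1 x - x = y := fun y => Iff.rfl
  rw [FillsMoveSet, Set.ext_iff]
  constructor
  · intro h x hx
    exact (hmod _).1 ((h _).2 ⟨(hmov _).2 ⟨x, rfl⟩, hx⟩)
  · intro h y
    rw [hmod, Set.mem_inter_iff, hmov]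
    constructor
    · rintro ⟨z, hz, rfl⟩
      exact ⟨⟨z, rfl⟩, Submodule.sub_mem _ (map_mem_corootLattice w hz) hz⟩
    · rintro ⟨⟨x, rfl⟩, hx⟩
      exact h x hx

theorem FillsMoveSet.of_isConj {w w' : weylGroup n} (hc : IsConj w w') (h : FillsMoveSet n w) :
    FillsMoveSet n w' := by
  obtain ⟨g, rfl⟩ := isConj_iff.1 hc
  rw [fillsMoveSet_iff] at h ⊢
  have hg : ∀ x, g.1 (g⁻¹.1 x) = x := fun x => g.1.apply_symm_apply x
  have hg' : ∀ x, g⁻¹.1 (g.1 x) = x := fun x => g.1.symm_apply_apply x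
  have happ : ∀ x, (g * w * g⁻¹).1 x = g.1 (w.1 (g⁻¹.1 x)) := fun _ => rfl
  intro x hx
  obtain ⟨z, hz, hzx⟩ := h (g⁻¹.1 x) (by
    have := map_mem_corootLattice g⁻¹ hx
    rwa [happ, map_sub, hg'] at this)
  refine ⟨g.1 z, map_mem_corootLattice g hz, ?_⟩
  rw [happ, hg', happ, ← map_sub, hzx, map_sub, hg]

/-- A permutation fills its move-set: if `u x - x` is integral, then it does not change when every
coordinate of `x` is replaced by its integer part. -/
theorem fillsMoveSet_of_mem_parabolicA {u : weylGroup n} (hu : u ∈ parabolicA n) :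
    FillsMoveSet n u := by
  obtain ⟨σ, h⟩ := exists_actsBy_one_of_mem_parabolicA hu
  rw [fillsMoveSet_iff]
  intro x hx
  refine ⟨WithLp.toLp 2 fun i => (⌊x i⌋ : ℝ), ?_, ?_⟩
  · rw [mem_corootLattice_iff]
    exact fun i => ⟨⌊x i⌋, rfl⟩
  · rw [mem_corootLattice_iff] at hx
    ext k
    obtain ⟨i, rfl⟩ := σ.surjective k
    obtain ⟨m, hm⟩ := hx (σ i)
    simp only [PiLp.sub_apply, h.apply_coord, Pi.one_apply, one_mul] at hm ⊢
    rw [hm, show x i = x (σ i) + m by linarith, Int.floor_add_intCast]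
    push_cast
    ring

/-! ### Blocks as signed cycles -/

theorem mul_apply (u v : weylGroup n) (x : V n) : (u * v).1 x = u.1 (v.1 x) := rfl

/-- With respect to the vectors `F 0, …, F (n - 1)`, the element `u` is the signed cycle
`F j ↦ F (j + 1) ↦ ⋯ ↦ F (j + b - 1) ↦ ε • F j`, and it fixes the other vectors. -/
structure IsBlock (F : ℕ → V n) (ε : ℝ) (j b : ℕ) (u : weylGroup n) : Prop where
  step : ∀ k, j ≤ k → k + 1 < j + b → u.1 (F k) = F (k + 1)
  last : u.1 (F (j + b - 1)) = ε • F j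
  fixed : ∀ k, k < n → (k < j ∨ j + b ≤ k) → u.1 (F k) = F k

/-- A product `R_j R_{j+1} ⋯ R_{j+c-1}` of adjacent transpositions of the vectors `F k` is a cycle
of length `c + 1`. -/
theorem isBlock_prod_swaps {F : ℕ → V n} {R : ℕ → weylGroup n}
    (hR : ∀ i, i + 1 < n → ∀ k < n, (R i).1 (F k) = F (Equiv.swap i (i + 1) k)) (j c : ℕ)
    (hc : j + c < n) :
    IsBlock F 1 j (c + 1) ((List.range c).map fun i => R (j + i)).prod := by
  induction c with
  | zero =>
    exact ⟨fun k _ _ => by omega, by simp, fun k _ _ => by simp⟩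
  | succ c ih =>
    have h := ih (by omega)
    rw [List.range_succ, List.map_append, List.prod_append, List.map_singleton,
      List.prod_singleton]
    refine ⟨fun k hjk hk => ?_, ?_, fun k hkn hk => ?_⟩
    · rw [mul_apply, hR _ (by omega) k (by omega)]
      rcases eq_or_ne k (j + c) with rfl | hne
      · rw [Equiv.swap_apply_left, h.fixed _ (by omega) (by omega)]
      · rw [Equiv.swap_apply_of_ne_of_ne hne (by omega), h.step k hjk (by omega)]
    · rw [mul_apply, hR _ (by omega) _ (by omega),
        show j + (c + 1 + 1) - 1 = j + c + 1 by omega, Equiv.swap_apply_right]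
      exact h.last
    · rw [mul_apply, hR _ (by omega) k hkn, Equiv.swap_apply_of_ne_of_ne (by omega) (by omega),
        h.fixed k hkn (by omega)]

/-- Composing a cycle with the rescaling of `F j` by `ε` makes it close up with the factor `ε`. -/
theorem IsBlock.mul_left {F : ℕ → V n} {ε : ℝ} {j c : ℕ} {u v : weylGroup n}
    (h : IsBlock F 1 j (c + 1) u) (hc : j + c < n) (hv : v.1 (F j) = ε • F j)
    (hv' : ∀ k < n, k ≠ j → v.1 (F k) = F k) : IsBlock F ε j (c + 1) (v * u) := by
  refine ⟨fun k hjk hk => ?_, ?_, fun k hkn hk => ?_⟩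
  · rw [mul_apply, h.step k hjk hk, hv' _ (by omega) (by omega)]
  · rw [mul_apply, h.last, one_smul, hv]
  · rw [mul_apply, h.fixed k hkn hk, hv' k hkn (by omega)]

theorem isBlock_posBlock (j b : ℕ) (hb : 1 ≤ b) (hn : j + b ≤ n) :
    IsBlock (fun k => stdVec n (k + 1)) 1 j b (posBlock n j b) := by
  obtain ⟨c, rfl⟩ : ∃ c, b = c + 1 := ⟨b - 1, by omega⟩
  have h := isBlock_prod_swaps (F := fun k => stdVec n (k + 1)) (R := fun i => s n (i + 1))
    (fun i hi k _ => by
      rw [s_apply (by omega) hi]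
      congr 1
      simp only [Equiv.swap_apply_def]
      split_ifs <;> omega) j c (by omega)
  have hp : posBlock n j (c + 1) = ((List.range c).map fun i => s n (j + i + 1)).prod := by
    simp [posBlock, Nat.add_right_comm]
  rw [hp]
  exact h

theorem s_sub_apply {i k : ℕ} (hi : i + 1 < n) (hk : k < n) :
    (s n (n - (i + 1))).1 (stdVec n (n - k)) = stdVec n (n - Equiv.swap i (i + 1) k) := by
  rw [s_apply (by omega) (by omega)]
  congr 1
  simp only [Equiv.swap_apply_def]
  split_ifs <;> omega

/-- `t_j` is the reflection that changes the sign of `e_{n-j}`. -/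
theorem t_apply {j k : ℕ} (hj : j < n) (hk : k < n) :
    (t n j).1 (stdVec n (n - k)) = if k = j then -stdVec n (n - k) else stdVec n (n - k) := by
  induction j generalizing k with
  | zero =>
    split_ifs with h
    · subst h
      exact s_last_apply_last hj
    · exact s_last_apply_of_ne (by omega)
  | succ j ih =>
    have hswap : Equiv.swap j (j + 1) k < n := by
      rw [Equiv.swap_apply_def]
      split_ifs <;> omega
    rw [t, mul_apply, mul_apply, s_sub_apply hj hk, ih (by omega) hswap, apply_ite (s n _).1,
      map_neg, s_sub_apply hj hswap, Equiv.swap_apply_self]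
    have hiff : Equiv.swap j (j + 1) k = j ↔ k = j + 1 := by
      rw [Equiv.swap_apply_def]
      split_ifs <;> omega
    simp only [hiff]

theorem isBlock_negBlock (j b : ℕ) (hb : 1 ≤ b) (hn : j + b ≤ n) :
    IsBlock (fun k => stdVec n (n - k)) (-1) j b (negBlock n j b) := by
  obtain ⟨c, rfl⟩ : ∃ c, b = c + 1 := ⟨b - 1, by omega⟩
  have h := isBlock_prod_swaps (F := fun k => stdVec n (n - k))
    (R := fun i => s n (n - (i + 1))) (fun i hi k hk => s_sub_apply hi hk) j c (by omega)
  have hp : negBlock n j (c + 1) =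
      t n j * ((List.range c).map fun i => s n (n - (j + i + 1))).prod := by
    simp [negBlock, Nat.add_right_comm]
  rw [hp]
  refine h.mul_left (by omega) ?_ fun k hk hkj => ?_
  · rw [t_apply (by omega) (by omega), if_pos rfl, neg_one_smul]
  · rw [t_apply (by omega) hk, if_neg hkj]

/-! ### Products of consecutive blocks -/

/-- The product of the blocks `B j b` whose lengths `b` run through a list, each starting where
the previous one ends. -/
noncomputable def blocksProd (B : ℕ → ℕ → weylGroup n) : ℕ → List ℕ → weylGroup n
  | _, [] => 1
  | j, b :: l => B j b * blocksProd B (j + b) l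

theorem posBlocks_eq (j : ℕ) (l : List ℕ) : posBlocks n j l = blocksProd (posBlock n) j l := by
  induction l generalizing j with
  | nil => rfl
  | cons b l ih => rw [posBlocks, blocksProd, ih]

theorem negBlocks_eq (j : ℕ) (l : List ℕ) : negBlocks n j l = blocksProd (negBlock n) j l := by
  induction l generalizing j with
  | nil => rfl
  | cons b l ih => rw [negBlocks, blocksProd, ih]

section blocksProd

variable {F : ℕ → V n} {ε : ℝ} {B : ℕ → ℕ → weylGroup n}

theorem blocksProd_fixed (hB : ∀ j b, 1 ≤ b → j + b ≤ n → IsBlock F ε j b (B j b))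
    {j : ℕ} {l : List ℕ} (hl : ∀ b ∈ l, 1 ≤ b) (hn : j + l.sum ≤ n) {k : ℕ} (hkn : k < n)
    (hk : k < j ∨ j + l.sum ≤ k) : (blocksProd B j l).1 (F k) = F k := by
  induction l generalizing j with
  | nil => rfl
  | cons b l ih =>
    rw [List.sum_cons] at hn hk
    rw [List.forall_mem_cons] at hl
    rw [blocksProd, mul_apply, ih hl.2 (by omega) (by omega),
      (hB j b hl.1 (by omega)).fixed k hkn (by omega)]

/-- A product of blocks sends each vector `F k` in the range it covers to a multiple of another
such vector. -/
theorem exists_blocksProd_apply (hB : ∀ j b, 1 ≤ b → j + b ≤ n → IsBlock F ε j b (B j b))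
    {j : ℕ} {l : List ℕ} (hl : ∀ b ∈ l, 1 ≤ b) (hn : j + l.sum ≤ n) {k : ℕ} (hjk : j ≤ k)
    (hk : k < j + l.sum) : ∃ (a : ℝ) (k' : ℕ), j ≤ k' ∧ k' < j + l.sum ∧
      (blocksProd B j l).1 (F k) = a • F k' := by
  induction l generalizing j with
  | nil => simp at hk; omega
  | cons b l ih =>
    rw [List.sum_cons] at hn hk ⊢
    rw [List.forall_mem_cons] at hl
    have hb := hB j b hl.1 (by omega)
    simp only [blocksProd, mul_apply]
    rcases lt_or_ge k (j + b) with hlt | hge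
    · rw [blocksProd_fixed hB hl.2 (by omega) (by omega) (by omega)]
      rcases Nat.lt_or_ge (k + 1) (j + b) with hlt' | hge'
      · exact ⟨1, k + 1, by omega, by omega, by rw [hb.step k hjk hlt', one_smul]⟩
      · obtain rfl : k = j + b - 1 := by omega
        exact ⟨ε, j, le_rfl, by omega, hb.last⟩
    · obtain ⟨a, k', h1, h2, h3⟩ := ih hl.2 (by omega) hge (by omega)
      refine ⟨a, k', by omega, by omega, ?_⟩
      rw [h3, map_smul, hb.fixed k' (by omega) (by omega)]

/-- The pairs `(i, k)` with `k < b`, for `(i, b)` running through the list `L`. A pair `(i, b)`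
stands for the orbit segment of length `b` that starts at `i`, and `(i, k)` for its `k`-th point. -/
def segmentPoints (L : List (Fin n × ℕ)) : List (Fin n × ℕ) :=
  L.flatMap fun c => (List.range c.2).map fun k => (c.1, k)

/-- The vector `w ^ k e_i` (with `i` counted from `0`). -/
noncomputable def orbitVec (w : weylGroup n) (x : Fin n × ℕ) : V n :=
  (w ^ x.2).1 (stdVec n (x.1 + 1))

theorem length_segmentPoints (L : List (Fin n × ℕ)) :
    (segmentPoints L).length = (L.map Prod.snd).sum := by
  simp [segmentPoints, List.length_flatMap]

theorem segmentPoints_cons (i : Fin n) (b : ℕ) (L : List (Fin n × ℕ)) :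
    segmentPoints ((i, b) :: L) =
      ((List.range b).map fun k => (i, k)) ++ segmentPoints L := rfl

theorem pow_succ_apply (w : weylGroup n) (k : ℕ) (x : V n) :
    (w ^ (k + 1)).1 x = w.1 ((w ^ k).1 x) := by
  rw [pow_succ', mul_apply]

/-- If `g` carries consecutive vectors `F k` to concatenated orbit segments of `w`, each of which
closes up with the sign `ε`, then `g` conjugates the product of blocks to `w` on these vectors. -/
theorem apply_blocksProd_eq (hB : ∀ j b, 1 ≤ b → j + b ≤ n → IsBlock F ε j b (B j b))
    {w g : weylGroup n} {j : ℕ} {L : List (Fin n × ℕ)}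
    (hL : ∀ c ∈ L, 1 ≤ c.2 ∧ (w ^ c.2).1 (stdVec n (c.1 + 1)) = ε • stdVec n (c.1 + 1))
    (hn : j + (L.map Prod.snd).sum ≤ n)
    (hg : ∀ m x, (segmentPoints L)[m]? = some x → g.1 (F (j + m)) = orbitVec w x)
    {k : ℕ} (hjk : j ≤ k) (hk : k < j + (L.map Prod.snd).sum) :
    g.1 ((blocksProd B j (L.map Prod.snd)).1 (F k)) = w.1 (g.1 (F k)) := by
  induction L generalizing j with
  | nil => simp at hk; omega
  | cons c L ih =>
    obtain ⟨i, b⟩ := c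
    rw [List.map_cons, List.sum_cons] at hn hk
    rw [List.forall_mem_cons] at hL
    obtain ⟨⟨hb1, hbw⟩, hL'⟩ := hL
    dsimp only at hb1 hbw hn hk
    have hb := hB j b hb1 (by omega)
    have hpos : ∀ b ∈ L.map Prod.snd, 1 ≤ b := by
      simp only [List.mem_map]
      rintro b ⟨c, hc, rfl⟩
      exact (hL' c hc).1
    rw [segmentPoints_cons] at hg
    have hghead : ∀ m < b, g.1 (F (j + m)) = (w ^ m).1 (stdVec n (i + 1)) := by
      intro m hm
      refine hg m (i, m) ?_
      rw [List.getElem?_append_left (by simpa using hm)]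
      simp [hm]
    simp only [List.map_cons, blocksProd, mul_apply]
    rcases lt_or_ge k (j + b) with hlt | hge
    · rw [blocksProd_fixed hB hpos (by omega) (by omega) (by omega)]
      obtain ⟨m, rfl⟩ := Nat.exists_eq_add_of_le hjk
      rw [hghead m (by omega), ← pow_succ_apply]
      rcases Nat.lt_or_ge (m + 1) b with hlt' | hge'
      · rw [hb.step _ hjk (by omega), add_assoc, hghead _ hlt']
      · obtain rfl : b = m + 1 := by omega
        have h0 := hghead 0 (by omega)
        have hlast := hb.last
        rw [show j + (m + 1) - 1 = j + m by omega] at hlast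
        rw [hlast, map_smul, hbw]
        congr 1
    · obtain ⟨a, k', h1, h2, h3⟩ := exists_blocksProd_apply hB hpos (by omega) hge (by omega)
      rw [h3, map_smul, hb.fixed k' (by omega) (by omega), ← h3]
      refine ih hL' (by omega) (fun m x hx => ?_) hge (by omega)
      rw [add_assoc]
      apply hg
      rw [List.getElem?_append_right (by simp)]
      simpa using hx

end blocksProd

/-! ### Classification of the conjugacy classes -/

/-- Every signed permutation lies in the Weyl group. -/
theorem exists_mem_weylGroup_actsBy (σ : Equiv.Perm (Fin n)) {a : Fin n → ℝ}
    (ha : ∀ i, a i = 1 ∨ a i = -1) : ∃ u : weylGroup n, ActsBy u.1 σ a := by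
  have hperm : ∀ σ : Equiv.Perm (Fin n), ∃ u : weylGroup n, ActsBy u.1 σ 1 := by
    intro σ
    obtain _ | m := n
    · exact ⟨1, fun i => i.elim0, fun i => i.elim0⟩
    have hσ : σ ∈ Submonoid.closure
        (Set.range fun i : Fin m => Equiv.swap i.castSucc i.succ) := by
      rw [Equiv.Perm.mclosure_swap_castSucc_succ]
      trivial
    induction hσ using Submonoid.closure_induction with
    | mem τ hτ =>
      obtain ⟨i, rfl⟩ := hτ
      exact ⟨s (m + 1) (i + 1), actsBy_s (by omega) (by omega)⟩
    | one => exact ⟨1, ActsBy.one⟩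
    | mul τ τ' _ _ h h' =>
      obtain ⟨u, hu⟩ := h
      obtain ⟨v, hv⟩ := h'
      exact ⟨u * v, actsBy_one_mul hu hv⟩
  have hsign : ∀ S : Finset (Fin n), ∃ u : weylGroup n, ∀ i : Fin n,
      u.1 (stdVec n (i + 1)) = (if i ∈ S then (-1 : ℝ) else 1) • stdVec n (i + 1) := by
    intro S
    induction S using Finset.induction_on with
    | empty => exact ⟨1, fun i => by simp⟩
    | insert j S hj ih =>
      obtain ⟨u, hu⟩ := ih
      refine ⟨t n (n - (j + 1)) * u, fun i => ?_⟩
      have ht := t_apply (n := n) (j := n - (j + 1)) (k := n - (i + 1)) (by omega) (by omega)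
      rw [show n - (n - ((i : ℕ) + 1)) = i + 1 by omega] at ht
      rw [mul_apply, hu, map_smul, ht]
      rcases eq_or_ne i j with rfl | hne
      · simp [hj]
      · have hne' : (i : ℕ) ≠ j := fun h => hne (Fin.ext h)
        have hne'' : n - ((i : ℕ) + 1) ≠ n - (j + 1) := by omega
        rw [if_neg hne'']
        simp [hne]
  obtain ⟨u, hu⟩ := hperm σ
  obtain ⟨v, hv⟩ := hsign (Finset.univ.filter fun i => a i = -1)
  refine ⟨u * v, ha, fun i => ?_⟩
  rw [mul_apply, hv, map_smul, hu.2, Pi.one_apply, one_smul]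
  congr 1
  rcases ha i with h | h
  · simp only [h, Finset.mem_filter, Finset.mem_univ, true_and]
    norm_num
  · simp [h]

/-- A permutation `σ` of `Fin n` is a concatenation of cycles `i, σ i, …, σ^[b - 1] i`. -/
theorem exists_cycle_list (σ : Equiv.Perm (Fin n)) : ∃ L : List (Fin n × ℕ),
    (∀ c ∈ L, 1 ≤ c.2 ∧ σ^[c.2] c.1 = c.1) ∧
    ((segmentPoints L).map fun x => σ^[x.2] x.1).Nodup ∧
    ∀ i, i ∈ (segmentPoints L).map fun x => σ^[x.2] x.1 := by
  suffices H : ∀ S : Finset (Fin n), (∀ i, σ i ∈ S ↔ i ∈ S) → ∃ L : List (Fin n × ℕ),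
      (∀ c ∈ L, 1 ≤ c.2 ∧ σ^[c.2] c.1 = c.1) ∧
      ((segmentPoints L).map fun x => σ^[x.2] x.1).Nodup ∧
      ∀ i, i ∈ ((segmentPoints L).map fun x => σ^[x.2] x.1) ↔ i ∈ S by
    obtain ⟨L, h1, h2, h3⟩ := H Finset.univ (by simp)
    exact ⟨L, h1, h2, fun i => (h3 i).2 (Finset.mem_univ i)⟩
  intro S
  induction S using Finset.strongInduction with
  | H S ih =>
    intro hS
    rcases S.eq_empty_or_nonempty with rfl | ⟨i, hi⟩
    · exact ⟨[], by simp, by simp [segmentPoints], by simp [segmentPoints]⟩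
    -- Split off the orbit `O` of `i`; the complement is again invariant.
    set b := Function.minimalPeriod σ i
    have hb1 : 0 < b := Function.minimalPeriod_pos_of_mem_periodicPts
      (σ.injective.mem_periodicPts i)
    have hbi : σ^[b] i = i := Function.iterate_minimalPeriod
    set O : Finset (Fin n) := (Finset.range b).image fun k => σ^[k] i with hO
    have hmemO : ∀ x, x ∈ O ↔ ∃ k < b, σ^[k] i = x := by simp [hO]
    have hiter : ∀ k, σ^[k] i ∈ O := fun k =>
      (hmemO _).2 ⟨k % b, Nat.mod_lt _ hb1, Function.iterate_mod_minimalPeriod_eq⟩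
    have hOS : ∀ x ∈ O, x ∈ S := by
      intro x hx
      obtain ⟨k, -, rfl⟩ := (hmemO x).1 hx
      induction k with
      | zero => exact hi
      | succ k ihk =>
        rw [Function.iterate_succ_apply', hS]
        exact ihk (hiter k)
    have hOinv : ∀ x, σ x ∈ O ↔ x ∈ O := by
      intro x
      constructor
      · intro hx
        obtain ⟨k, -, hk⟩ := (hmemO _).1 hx
        have h1 : σ (σ^[k + (b - 1)] i) = σ x := by
          rw [← Function.iterate_succ_apply' σ, show (k + (b - 1)).succ = k + b by omega,
            Function.iterate_add_apply, hbi, hk]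
        rw [← σ.injective h1]
        exact hiter _
      · intro hx
        obtain ⟨k, -, rfl⟩ := (hmemO _).1 hx
        rw [← Function.iterate_succ_apply' σ]
        exact hiter _
    obtain ⟨L, h1, h2, h3⟩ := ih (S \ O) (by
      refine Finset.ssubset_iff_subset_ne.2 ⟨Finset.sdiff_subset, fun h => ?_⟩
      rw [← h] at hi
      exact (Finset.mem_sdiff.1 hi).2 (hiter 0)) (fun x => by
        simp only [Finset.mem_sdiff, hS, hOinv])
    have hmap : ((segmentPoints ((i, b) :: L)).map fun x => σ^[x.2] x.1) =
        ((List.range b).map fun k => σ^[k] i) ++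
          (segmentPoints L).map fun x => σ^[x.2] x.1 := by
      simp [segmentPoints_cons, Function.comp_def]
    refine ⟨(i, b) :: L, ?_, ?_, ?_⟩
    · rw [List.forall_mem_cons]
      exact ⟨⟨hb1, hbi⟩, h1⟩
    · rw [hmap, List.nodup_append']
      refine ⟨List.Nodup.map_on ?_ List.nodup_range, h2, ?_⟩
      · intro x hx y hy hxy
        exact Function.iterate_injOn_Iio_minimalPeriod (List.mem_range.1 hx)
          (List.mem_range.1 hy) hxy
      · intro x hx hx'
        obtain ⟨k, -, rfl⟩ := List.mem_map.1 hx
        exact (Finset.mem_sdiff.1 ((h3 _).1 hx')).2 (hiter k)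
    · intro x
      rw [hmap, List.mem_append, h3, Finset.mem_sdiff]
      have hx : x ∈ ((List.range b).map fun k => σ^[k] i) ↔ x ∈ O := by simp [hmemO, eq_comm]
      rw [hx]
      have := hOS x
      tauto

theorem ActsBy.exists_orbitVec_eq {w : weylGroup n} {σ : Equiv.Perm (Fin n)} {a : Fin n → ℝ}
    (h : ActsBy w.1 σ a) (x : Fin n × ℕ) :
    ∃ c : ℝ, (c = 1 ∨ c = -1) ∧ orbitVec w x = c • stdVec n (σ^[x.2] x.1 + 1) := by
  obtain ⟨i, k⟩ := x
  simp only [orbitVec]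
  induction k with
  | zero => exact ⟨1, Or.inl rfl, by simp⟩
  | succ k ih =>
    obtain ⟨c, hc, hk⟩ := ih
    refine ⟨c * a (σ^[k] i), ?_, ?_⟩
    · rcases hc with hc | hc <;> rcases h.1 (σ^[k] i) with h' | h' <;> simp [hc, h']
    · rw [pow_succ_apply, hk, map_smul, h.2, smul_smul, Function.iterate_succ_apply' σ]

theorem wBeta_fixed {β γ : List ℕ} (h : IsPartitionPair n β γ) {k : ℕ} (hk : k < γ.sum) :
    (wBeta n β).1 (stdVec n (n - k)) = stdVec n (n - k) := by
  have hsum := h.sum_eq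
  have := blocksProd_fixed (n := n) isBlock_posBlock (j := 0) h.pos_left (by omega)
    (k := n - (k + 1)) (by omega) (by omega)
  rwa [← posBlocks_eq, show n - (k + 1) + 1 = n - k by omega] at this

theorem wGamma_fixed {β γ : List ℕ} (h : IsPartitionPair n β γ) {k : ℕ} (hk : k < β.sum) :
    (wGamma n γ).1 (stdVec n (k + 1)) = stdVec n (k + 1) := by
  have hsum := h.sum_eq
  have := blocksProd_fixed (n := n) isBlock_negBlock (j := 0) h.pos_right (by omega)
    (k := n - (k + 1)) (by omega) (by omega)
  rwa [← negBlocks_eq, show n - (n - (k + 1)) = k + 1 by omega] at this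

/-- Every conjugacy class is indexed by a pair of partitions: list the cycles of the signed
permutation `w`, those with sign `1` by decreasing and those with sign `-1` by increasing length;
the vectors met along them form a signed basis that is the image of the standard one under an
element of the Weyl group, and this element conjugates `w_{β,γ}` to `w`. -/
theorem exists_isIndexedBy (w : weylGroup n) : ∃ β γ : List ℕ, IsIndexedBy n w β γ := by
  classical
  obtain ⟨σ, a, hw⟩ := exists_actsBy w
  obtain ⟨L, hL, hnodup, hmem⟩ := exists_cycle_list σ
  set p : Fin n × ℕ → Bool := fun c => decide (orbitVec w c = stdVec n (c.1 + 1)) with hp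
  set P := (L.filter p).mergeSort fun c d => decide (d.2 ≤ c.2) with hP
  set N := (L.filter fun c => !p c).mergeSort fun c d => decide (c.2 ≤ d.2) with hN
  have hPL : ∀ c ∈ P, c ∈ L ∧ orbitVec w c = stdVec n (c.1 + 1) := by
    intro c hc
    simpa [hP, hp] using hc
  have hNL : ∀ c ∈ N, c ∈ L ∧ orbitVec w c ≠ stdVec n (c.1 + 1) := by
    intro c hc
    simpa [hN, hp] using hc
  have hperm : (P ++ N).Perm L :=
    ((List.mergeSort_perm _ _).append (List.mergeSort_perm _ _)).trans
      (List.filter_append_perm p L)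
  -- The negative cycles fill the coordinates from the last one downwards.
  set D := segmentPoints P ++ (segmentPoints N).reverse with hD
  have hDperm : D.Perm (segmentPoints L) := by
    refine ((List.reverse_perm _).append_left _).trans ?_
    rw [segmentPoints, segmentPoints, ← List.flatMap_append]
    exact hperm.flatMap_right _
  have hDmap := hDperm.map fun x => σ^[x.2] x.1
  have hDnodup := hDmap.nodup_iff.2 hnodup
  have hDlen : D.length = n := by
    have h1 := List.toFinset_card_of_nodup hDnodup
    have h2 : (D.map fun x => σ^[x.2] x.1).toFinset = Finset.univ := by
      ext i
      simp only [List.mem_toFinset, Finset.mem_univ, iff_true]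
      exact hDmap.mem_iff.2 (hmem i)
    rw [h2, Finset.card_univ, Fintype.card_fin, List.length_map] at h1
    exact h1.symm
  have hlenD : (P.map Prod.snd).sum + (N.map Prod.snd).sum = n := by
    refine Eq.trans ?_ hDlen
    rw [hD, List.length_append, List.length_reverse, length_segmentPoints,
      length_segmentPoints]
  have hpair : IsPartitionPair n (P.map Prod.snd) (N.map Prod.snd) := by
    refine ⟨?_, ?_, ?_, ?_, hlenD⟩
    · rw [List.forall_mem_map]
      exact fun c hc => (hL c (hPL c hc).1).1
    · rw [List.forall_mem_map]
      exact fun c hc => (hL c (hNL c hc).1).1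
    · rw [List.pairwise_map]
      have := List.pairwise_mergeSort (le := fun c d : Fin n × ℕ => decide (d.2 ≤ c.2))
        (fun a b c => by simp only [decide_eq_true_eq]; omega)
        (fun a b => by simp only [Bool.or_eq_true, decide_eq_true_eq]; omega) (L.filter p)
      simpa only [decide_eq_true_eq] using this
    · rw [List.pairwise_map]
      have := List.pairwise_mergeSort (le := fun c d : Fin n × ℕ => decide (c.2 ≤ d.2))
        (fun a b c => by simp only [decide_eq_true_eq]; omega)
        (fun a b => by simp only [Bool.or_eq_true, decide_eq_true_eq]; omega)
        (L.filter fun c => !p c)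
      simpa only [decide_eq_true_eq] using this
  obtain ⟨g, hg⟩ : ∃ g : weylGroup n, ∀ m x, D[m]? = some x →
      g.1 (stdVec n (m + 1)) = orbitVec w x := by
    choose c hc hcw using hw.exists_orbitVec_eq
    have hinj : Function.Injective fun m : Fin n =>
        (fun x : Fin n × ℕ => σ^[x.2] x.1) (D[(m : ℕ)]'(by omega)) := by
      intro m m' h
      have := hDnodup.getElem_inj_iff (i := m) (j := m') (hi := by simp [hDlen])
        (hj := by simp [hDlen])
      simp only [List.getElem_map] at this
      exact Fin.ext (this.1 h)
    obtain ⟨g, hg⟩ := exists_mem_weylGroup_actsBy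
      (Equiv.ofBijective _ (Finite.injective_iff_bijective.1 hinj))
      (a := fun m => c (D[(m : ℕ)]'(by omega))) fun _ => hc _
    refine ⟨g, fun m x hx => ?_⟩
    obtain ⟨hm, rfl⟩ := List.getElem?_eq_some_iff.1 hx
    rw [hcw]
    exact hg.2 ⟨m, by omega⟩
  refine ⟨P.map Prod.snd, N.map Prod.snd, hpair, isConj_iff.2 ⟨g⁻¹, ?_⟩⟩
  rw [inv_inv, mul_assoc, inv_mul_eq_iff_eq_mul]
  refine Subtype.ext (isometry_ext fun i => ?_)
  rw [mul_apply, mul_apply, mul_apply]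
  rcases lt_or_ge (i : ℕ) (P.map Prod.snd).sum with hi | hi
  · rw [wGamma_fixed hpair hi, wBeta, posBlocks_eq]
    refine (apply_blocksProd_eq isBlock_posBlock (j := 0) (k := i) (fun c hc => ?_) (by omega)
      (fun m x hx => ?_) (by omega) (by omega)).symm
    · rw [one_smul]
      exact ⟨(hL c (hPL c hc).1).1, (hPL c hc).2⟩
    · rw [Nat.zero_add]
      apply hg
      rw [hD, List.getElem?_append_left (List.getElem?_eq_some_iff.1 hx).1, hx]
  · have hk : n - ((i : ℕ) + 1) < (N.map Prod.snd).sum := by omega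
    have hik : (i : ℕ) + 1 = n - (n - (i + 1)) := by omega
    obtain ⟨a, k', -, h2, h3⟩ := exists_blocksProd_apply (n := n) isBlock_negBlock
      (j := 0) hpair.pos_right (by omega) (k := n - (i + 1)) (by omega) (by omega)
    have h4 : (wGamma n (N.map Prod.snd)).1 (stdVec n (i + 1)) = a • stdVec n (n - k') := by
      rw [hik, wGamma, negBlocks_eq]
      exact h3
    rw [h4, map_smul, wBeta_fixed hpair (by omega), ← h4, wGamma, negBlocks_eq, hik]
    refine (apply_blocksProd_eq isBlock_negBlock (j := 0) (k := n - (i + 1)) (fun c hc => ?_)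
      (by omega) (fun m x hx => ?_) (by omega) (by omega)).symm
    · obtain ⟨hcL, hne⟩ := hNL c hc
      refine ⟨(hL c hcL).1, ?_⟩
      obtain ⟨e, he, hce⟩ := hw.exists_orbitVec_eq c
      rw [(hL c hcL).2] at hce
      rcases he with rfl | rfl
      · rw [one_smul] at hce
        exact absurd hce hne
      · exact hce
    · have hm := (List.getElem?_eq_some_iff.1 hx).1
      have hm' := hm
      rw [length_segmentPoints] at hm'
      have hidx : D[n - (m + 1)]? = some x := by
        rw [hD, List.getElem?_append_right (by rw [length_segmentPoints]; omega),
          List.getElem?_reverse (by simp only [length_segmentPoints]; omega), ← hx]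
        congr 1
        simp only [length_segmentPoints]
        omega
      rw [← hg _ _ hidx]
      congr 2
      omega

/-! ### The two kinds of representatives -/

/-- A negative cycle `F 0 ↦ F 1 ↦ ⋯ ↦ F (c - 1) ↦ -F 0` produces the lattice vector
`F 0 = (w - Id) x` with `x = -½ ∑ F k`. For a lattice vector `z` with the same image, the vector
`z - x` is fixed by `w`, hence orthogonal to `F 0`, and the `F 0`-coordinate of `z` would
be `-½`. -/
theorem not_fillsMoveSet {β γ : List ℕ} (h : IsPartitionPair n β γ) (hγ : γ.sum ≠ 0) :
    ¬ FillsMoveSet n (wBeta n β * wGamma n γ) := by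
  obtain _ | ⟨c, γ⟩ := γ
  · simp at hγ
  have hsum := h.sum_eq
  rw [List.sum_cons] at hsum
  have hpos := List.forall_mem_cons.1 h.pos_right
  obtain ⟨d, rfl⟩ : ∃ d, c = d + 1 := ⟨c - 1, by have := hpos.1; omega⟩
  have hblock := isBlock_negBlock (n := n) 0 (d + 1) hpos.1 (by omega)
  set w := wBeta n β * wGamma n ((d + 1) :: γ) with hw
  have hwγ : ∀ k < d + 1, (wGamma n ((d + 1) :: γ)).1 (stdVec n (n - k)) =
      (negBlock n 0 (d + 1)).1 (stdVec n (n - k)) := by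
    intro k hk
    rw [wGamma, negBlocks, mul_apply, negBlocks_eq]
    exact congrArg _ (blocksProd_fixed isBlock_negBlock hpos.2 (by omega) (by omega) (by omega))
  have hstep : ∀ k < d, w.1 (stdVec n (n - k)) = stdVec n (n - (k + 1)) := by
    intro k hk
    have h1 := hblock.step k (by omega) (by omega)
    rw [hw, mul_apply, hwγ k (by omega), h1, wBeta_fixed h (by rw [List.sum_cons]; omega)]
  have hlast : w.1 (stdVec n (n - d)) = -stdVec n (n - 0) := by
    have h1 := hblock.last
    rw [show 0 + (d + 1) - 1 = d by omega, neg_one_smul] at h1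
    rw [hw, mul_apply, hwγ d (by omega), h1, map_neg,
      wBeta_fixed h (by rw [List.sum_cons]; omega)]
  rw [fillsMoveSet_iff]
  intro hfill
  set x : V n := (-(1 / 2 : ℝ)) • ∑ k ∈ Finset.range (d + 1), stdVec n (n - k) with hx
  have hwx : w.1 x - x = stdVec n (n - 0) := by
    have h1 : w.1 (∑ k ∈ Finset.range (d + 1), stdVec n (n - k)) =
        ∑ k ∈ Finset.range d, stdVec n (n - (k + 1)) - stdVec n (n - 0) := by
      rw [map_sum, Finset.sum_range_succ, hlast, sub_eq_add_neg]
      congr 1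
      exact Finset.sum_congr rfl fun k hk => hstep k (Finset.mem_range.1 hk)
    rw [hx, map_smul, h1, Finset.sum_range_succ' _ d]
    module
  have hcoord : ∀ (k : ℕ) (hk : k < n) (y : V n),
      inner ℝ (stdVec n (n - k)) y = y ⟨n - (k + 1), by omega⟩ := by
    intro k hk y
    rw [← inner_stdVec]
    congr 2
    simp only
    omega
  obtain ⟨z, hz, hzx⟩ := hfill x (by
    rw [hwx, mem_corootLattice_iff]
    intro i
    exact ⟨if (i : ℕ) + 1 = n - 0 then 1 else 0, by simp [stdVec]⟩)
  have hfix : w.1 (z - x) = z - x := by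
    rw [map_sub, ← sub_eq_zero, ← sub_eq_zero.2 hzx]
    abel
  have hconst : ∀ k ≤ d, inner ℝ (stdVec n (n - k)) (z - x) =
      inner ℝ (stdVec n (n - 0)) (z - x) := by
    intro k
    induction k with
    | zero => intro _; rfl
    | succ k ih =>
      intro hk
      rw [← ih (by omega), ← hstep k (by omega), ← w.1.inner_map_map (stdVec n (n - k)), hfix]
  have hzero : inner ℝ (stdVec n (n - 0)) (z - x) = 0 := by
    have h1 := hconst d le_rfl
    rw [← w.1.inner_map_map, hlast, hfix, inner_neg_left] at h1
    linarith
  have hx0 : inner ℝ (stdVec n (n - 0)) x = -(1 / 2 : ℝ) := by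
    rw [hx, inner_smul_right, inner_sum, Finset.sum_range_succ' _ d, Finset.sum_eq_zero]
    · rw [inner_stdVec_stdVec (by omega) (by omega), if_pos rfl]
      norm_num
    · intro k hk
      rw [Finset.mem_range] at hk
      rw [inner_stdVec_stdVec (by omega) (by omega), if_neg (by omega)]
  rw [inner_sub_right, hx0, hcoord 0 (by omega)] at hzero
  obtain ⟨m, hm⟩ := (mem_corootLattice_iff z).1 hz ⟨n - (0 + 1), by omega⟩
  rw [hm] at hzero
  have h2 : ((2 * m + 1 : ℤ) : ℝ) = 0 := by
    push_cast
    linarith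
  have h3 : 2 * m + 1 = 0 := by exact_mod_cast h2
  omega

theorem wBeta_mem_parabolicA {β : List ℕ} (hpos : ∀ b ∈ β, 1 ≤ b) (hn : β.sum ≤ n) :
    wBeta n β ∈ parabolicA n := by
  suffices H : ∀ j, j + β.sum ≤ n → posBlocks n j β ∈ parabolicA n from H 0 (by omega)
  clear hn
  induction β with
  | nil => exact fun j _ => one_mem _
  | cons b β ih =>
    intro j hj
    rw [List.sum_cons] at hj
    rw [List.forall_mem_cons] at hpos
    refine mul_mem (list_prod_mem ?_) (ih hpos.2 _ (by omega))
    rw [List.forall_mem_map]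
    intro i hi
    rw [List.mem_range] at hi
    exact Subgroup.subset_closure ⟨_, by omega, by omega, rfl⟩

end TypeC

theorem corollary1p7 (n : ℕ) (hn : 2 ≤ n) (w : TypeC.weylGroup n) :
    (∃ β γ : List ℕ, TypeC.IsIndexedBy n w β γ) ∧
    ∀ β γ : List ℕ, TypeC.IsIndexedBy n w β γ →
      List.TFAE [
        TypeC.FillsMoveSet n w,
        TypeC.wBeta n β ∈ TypeC.parabolicA n ∧ IsConj w (TypeC.wBeta n β),
        ∃ u ∈ TypeC.parabolicA n, IsConj w u,
        γ.sum = 0] := by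
  refine ⟨TypeC.exists_isIndexedBy w, fun β γ ⟨hpair, hconj⟩ => ?_⟩
  have hsum := hpair.sum_eq
  tfae_have 1 → 4 := fun h => by
    by_contra hγ
    exact TypeC.not_fillsMoveSet hpair hγ (h.of_isConj hconj)
  tfae_have 4 → 2 := fun h => by
    obtain rfl : γ = [] := by
      refine List.eq_nil_iff_forall_not_mem.2 fun c hc => ?_
      have h1 := hpair.pos_right c hc
      have h2 := List.sum_eq_zero_iff.1 h c hc
      omega
    refine ⟨TypeC.wBeta_mem_parabolicA hpair.pos_left (by omega), ?_⟩
    rwa [show TypeC.wGamma n [] = 1 from rfl, mul_one] at hconj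
  tfae_have 2 → 3 := fun h => ⟨_, h⟩
  tfae_have 3 → 1 := fun ⟨u, hu, hwu⟩ =>
    (TypeC.fillsMoveSet_of_mem_parabolicA hu).of_isConj hwu.symm
  tfae_finish
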